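/- Let $M$ and $N$ be smooth $n$-dimensional manifolds (without boundary). Let $\mathrm{Diff}(N,M)$ be the set of smooth diffeomorphisms $N\to M$ with its functional diffeology (plots are the families $r\mapsto f_r$, $r\in\mathbb R^k$, for which $(r,x)\mapsto f_r(x)$ and $(r,y)\mapsto f_r^{-1}(y)$ are smooth), and $\mathrm{Diff}(M)=\mathrm{Diff}(M,M)$. Let $\mathfrak{diff}(M)=\Gamma(TM)$ be the space of smooth vector fields with bracket $[X,Y]_{\mathfrak{diff}(M)}=-[X,Y]_{\Gamma(TM)}$. Let the field space $\Phi$ be a diffeological space with a smooth right action $(\phi,\psi)\mapsto R_\psi\phi=\phi^\psi$ of $\mathrm{Diff}(M)$, so that $R_{\psi'}R_\psi=R_{\psi\circ\psi'}$ (for example a space of tensor fields on $M$ with $\phi^\psi=\psi^*\phi$). Let $\boldsymbol u:\Phi\to\mathrm{Diff}(N,M)$ be a field-dependent dressing field, i.e. a smooth map with $$\boldsymbol u(\phi^\psi)=\psi^{-1}\circ\boldsymbol u(\phi)\qquad\text{for all }\phi\in\Phi,\ \psi\in\mathrm{Diff}(M).$$ For a smooth family of fields $p:\mathbb R^k\to\Phi$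 (a plot), $r,v\in\mathbb R^k$ and $m\in M$ put $$(p^\star\boldsymbol\omega_0)_r(v)(m)=-\,\partial_v\big[\boldsymbol u(p(\cdot))(x)\big](r)\in T_mM,\qquad x=\boldsymbol u(p(r))^{-1}(m),$$ i.e. $\boldsymbol\omega_0=-\boldsymbol{du}\circ\boldsymbol u^{-1}$. Then $\boldsymbol\omega_0$ is a flat Ehresmann connection on $\Phi$, that is: 1. $\boldsymbol\omega_0$ is a smooth differential 1-form on $\Phi$ with values in $\mathfrak{diff}(M)$: on every plot it is linear in $v$ and jointly smooth in $(r,m)$, and it is compatible with smooth reparametrisations of plots. 2. (Verticality) $\boldsymbol\omega_0|_\phi(X^v|_\phi)=X$ for all $\phi\in\Phi$ and $X\in\mathfrak{diff}(M)$, where $X^v|_\phi=\frac{d}{d\tau}R_{\psi_\tau}\phi\,\big|_{\tau=0}$, for any smooth curve $\psi_\tau$ in $\mathrm{Diff}(M)$ with $\psi_0=\mathrm{id}_M$ and $\frac{d}{d\tau}\psi_\tau|_{\tau=0}=X$ (e.g. the flow of $X$, if $X$ is complete). 3. (Equivariance) $R_\psi^\star\boldsymbol\omega_0=(\psi^{-1})_*\,\boldsymbol\omega_0\circ\psi$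 for all $\psi\in\mathrm{Diff}(M)$. 4. (Flatness) $\boldsymbol d\boldsymbol\omega_0+\tfrac12[\boldsymbol\omega_0,\boldsymbol\omega_0]_{\mathfrak{diff}(M)}=0$, where $[\boldsymbol\alpha,\boldsymbol\beta](v,w)=[\boldsymbol\alpha(v),\boldsymbol\beta(w)]-[\boldsymbol\alpha(w),\boldsymbol\beta(v)]$. -/

import Mathlib

open scoped Manifold ContDiff
open Diffeology

noncomputable section

namespace FieldSpace

/-- The parameter space `ℝᵏ`, the domain of the plots of a diffeological space. -/
abbrev Par (k : ℕ) : Type := EuclideanSpace ℝ (Fin k)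

/-- `Diff(N, M)`: the smooth diffeomorphisms `N → M` between `n`-dimensional manifolds. -/
abbrev Diff (n : ℕ) (N M : Type*)
    [TopologicalSpace N] [ChartedSpace (EuclideanSpace ℝ (Fin n)) N]
    [TopologicalSpace M] [ChartedSpace (EuclideanSpace ℝ (Fin n)) M] : Type _ :=
  Diffeomorph (𝓡 n) (𝓡 n) N M ∞

section Diffeology

variable {n : ℕ} {N M : Type*}
  [TopologicalSpace N] [ChartedSpace (EuclideanSpace ℝ (Fin n)) N]
  [TopologicalSpace M] [ChartedSpace (EuclideanSpace ℝ (Fin n)) M]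

/-- The family `r ↦ p r` of diffeomorphisms is smooth on `U`: both `(r, x) ↦ p r x` and
`(r, y) ↦ (p r)⁻¹ y` are jointly smooth. -/
def IsSmoothFamilyOn {k : ℕ} (U : Set (Par k)) (p : Par k → Diff n N M) : Prop :=
  ContMDiffOn (𝓘(ℝ, Par k).prod (𝓡 n)) (𝓡 n) ∞
      (fun x : Par k × N => p x.1 x.2) (U ×ˢ Set.univ) ∧
    ContMDiffOn (𝓘(ℝ, Par k).prod (𝓡 n)) (𝓡 n) ∞
      (fun y : Par k × M => (p y.1).symm y.2) (U ×ˢ Set.univ)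

/-- The functional diffeology of `Diff(N, M)`: the plots are the smooth families of
diffeomorphisms. For `N = M` it is the standard diffeology of the group `Diff(M)`. -/
instance : DiffeologicalSpace (Diff n N M) :=
  .ofCorePlotsOn {
    isPlotOn := fun {_ U} _ p => IsSmoothFamilyOn U p
    isPlotOn_congr := by
      intro k U hU p q h
      refine and_congr (contMDiffOn_congr ?_) (contMDiffOn_congr ?_)
      · rintro ⟨r, x⟩ hx
        simp only [h hx.1]
      · rintro ⟨r, x⟩ hx
        simp only [h hx.1]
    isPlot_const := by
      intro k φ
      exact ⟨(φ.contMDiff.comp contMDiff_snd).contMDiffOn,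
        (φ.symm.contMDiff.comp contMDiff_snd).contMDiffOn⟩
    isPlotOn_reparam := by
      intro k l U V hU hV p f h hp hf
      have key_N : ContMDiffOn (𝓘(ℝ, Par l).prod (𝓡 n)) (𝓘(ℝ, Par k).prod (𝓡 n)) ∞
          (fun x : Par l × N => (f x.1, x.2)) (V ×ˢ Set.univ) :=
        (hf.contMDiffOn.comp contMDiffOn_fst fun x hx => hx.1).prodMk contMDiffOn_snd
      have key_M : ContMDiffOn (𝓘(ℝ, Par l).prod (𝓡 n)) (𝓘(ℝ, Par k).prod (𝓡 n)) ∞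
          (fun x : Par l × M => (f x.1, x.2)) (V ×ˢ Set.univ) :=
        (hf.contMDiffOn.comp contMDiffOn_fst fun x hx => hx.1).prodMk contMDiffOn_snd
      exact ⟨hp.1.comp key_N fun x hx => ⟨h hx.1, trivial⟩,
        hp.2.comp key_M fun x hx => ⟨h hx.1, trivial⟩⟩
    locality := by
      intro k U hU p hp
      constructor
      · rintro ⟨r, x⟩ hx
        obtain ⟨V, hV, hrV, h⟩ := hp r hx.1
        exact (h.1.contMDiffAt ((hV.prod isOpen_univ).mem_nhds ⟨hrV, trivial⟩)).contMDiffWithinAt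
      · rintro ⟨r, x⟩ hx
        obtain ⟨V, hV, hrV, h⟩ := hp r hx.1
        exact (h.2.contMDiffAt ((hV.prod isOpen_univ).mem_nhds ⟨hrV, trivial⟩)).contMDiffWithinAt }

end Diffeology

/-- A smooth right action `R_ψ φ = φ^ψ` of the group `Diff(M)` on a diffeological space `Φ`. -/
structure RightAction (n : ℕ) (M Φ : Type*)
    [TopologicalSpace M] [ChartedSpace (EuclideanSpace ℝ (Fin n)) M]
    [DiffeologicalSpace Φ] where
  /-- `act φ ψ = R_ψ φ = φ^ψ`. -/
  act : Φ → Diff n M M → Φ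
  act_id : ∀ φ, act φ (Diffeomorph.refl (𝓡 n) M ∞) = φ
  /-- `R_{ψ'} R_ψ φ = R_{ψ ∘ ψ'} φ`. -/
  act_comp : ∀ φ (ψ ψ' : Diff n M M), act (act φ ψ) ψ' = act φ (ψ'.trans ψ)
  /-- The map `Φ × Diff(M) → Φ` is smooth for the product diffeology. -/
  smooth : ∀ {k : ℕ} (p : Par k → Φ) (ψ : Par k → Diff n M M),
    IsPlot p → IsPlot ψ → IsPlot fun r => act (p r) (ψ r)

section Forms

variable {n : ℕ} {N M Φ : Type*}
  [TopologicalSpace N] [ChartedSpace (EuclideanSpace ℝ (Fin n)) N]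
  [TopologicalSpace M] [ChartedSpace (EuclideanSpace ℝ (Fin n)) M]
  [DiffeologicalSpace Φ]

/-- A field-dependent dressing field: a smooth map `u : Φ → Diff(N, M)` such that
`u(φ^ψ) = ψ⁻¹ ∘ u(φ)`. -/
structure IsDressingField (R : RightAction n M Φ) (u : Φ → Diff n N M) : Prop where
  smooth : DSmooth u
  equivariant : ∀ φ (ψ : Diff n M M), u (R.act φ ψ) = (u φ).trans ψ.symm

variable (n M Φ) in
/-- Raw data of a 1-form on `Φ` with values in the vector fields on `M`: to a plot
`p : ℝᵏ → Φ`, a parameter `r ∈ ℝᵏ` and a vector `v ∈ ℝᵏ`, it assigns the vector field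
`(p^*α)_r(v)` on `M`. -/
abbrev PreOneForm : Type _ :=
  ∀ {k : ℕ}, (Par k → Φ) → Par k → Par k → ∀ m : M, TangentSpace (𝓡 n) m

/-- `α` is a differential 1-form on the diffeological space `Φ` with values in the space
`Γ(TM)` of smooth vector fields: on every plot, it is linear in the tangent vector, jointly
smooth in the parameter and the point of `M`, and it is compatible with smooth
reparametrisations of plots. -/
structure IsOneForm [IsManifold (𝓡 n) ∞ M] (α : PreOneForm n M Φ) : Prop where
  map_add : ∀ {k : ℕ} (p : Par k → Φ), IsPlot p → ∀ (r v w : Par k) (m : M),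
    α p r (v + w) m = α p r v m + α p r w m
  map_smul : ∀ {k : ℕ} (p : Par k → Φ), IsPlot p → ∀ (r : Par k) (c : ℝ) (v : Par k) (m : M),
    α p r (c • v) m = c • α p r v m
  smooth : ∀ {k : ℕ} (p : Par k → Φ), IsPlot p → ∀ v : Par k,
    ContMDiff (𝓘(ℝ, Par k).prod (𝓡 n)) (𝓡 n).tangent ∞
      (fun x : Par k × M => (⟨x.2, α p x.1 v x.2⟩ : TangentBundle (𝓡 n) M))
  reparam : ∀ {k l : ℕ} (p : Par k → Φ) (f : Par l → Par k), IsPlot p → ContDiff ℝ ∞ f →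
    ∀ (s w : Par l) (m : M), α (p ∘ f) s w m = α p (f s) (fderiv ℝ f s w) m

/-- The value `α(ċ(0))` of a 1-form on the tangent vector `d/dτ c(τ) |_{τ=0}` at `c(0)` of a
smooth curve `c : ℝ → Φ`. -/
def evalVelocity (α : PreOneForm n M Φ) (c : ℝ → Φ) : ∀ m : M, TangentSpace (𝓡 n) m :=
  α (fun r : Par 1 => c (r 0)) 0 (EuclideanSpace.single 0 1)

/-- `ψ_τ` is a smooth curve in `Diff(M)` through `id_M` with `d/dτ ψ_τ |_{τ=0} = X`
(for instance, the flow of a complete vector field `X`). -/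
structure Generates (ψ : ℝ → Diff n M M) (X : ∀ m : M, TangentSpace (𝓡 n) m) : Prop where
  smooth : DSmooth ψ
  at_zero : ψ 0 = Diffeomorph.refl (𝓡 n) M ∞
  velocity : ∀ m : M, mfderiv 𝓘(ℝ, ℝ) (𝓡 n) (fun τ : ℝ => ψ τ m) 0 (1 : ℝ) = X m

/-- An Ehresmann connection on `Φ`: a `𝔡𝔦𝔣𝔣(M)`-valued 1-form `θ` such that `θ(X^v) = X`, where
`X^v` at `φ` is the fundamental vertical vector `d/dτ R_{ψ_τ} φ |_{τ=0}` generated by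
`X = d/dτ ψ_τ |_{τ=0}`, and such that `R_ψ^* θ = (ψ⁻¹)_* θ ∘ ψ`. -/
structure IsEhresmannConnection [IsManifold (𝓡 n) ∞ M] (R : RightAction n M Φ)
    (θ : PreOneForm n M Φ) : Prop where
  isOneForm : IsOneForm θ
  vertical : ∀ (φ : Φ) (X : ∀ m : M, TangentSpace (𝓡 n) m) (ψ : ℝ → Diff n M M),
    Generates ψ X → evalVelocity θ (fun τ => R.act φ (ψ τ)) = X
  equivariant : ∀ (ψ : Diff n M M) {k : ℕ} (p : Par k → Φ), IsPlot p →
    ∀ (r v : Par k) (m : M),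
      θ (fun s => R.act (p s) ψ) r v m = mfderiv (𝓡 n) (𝓡 n) ψ.symm (ψ m) (θ p r v (ψ m))

/-- The bracket of `𝔡𝔦𝔣𝔣(M)`: minus the Lie bracket of vector fields on `M`. -/
def diffBracket (X Y : ∀ m : M, TangentSpace (𝓡 n) m) (m : M) : TangentSpace (𝓡 n) m :=
  -VectorField.mlieBracket (𝓡 n) X Y m

/-- The exterior derivative of a 1-form, on a plot:
`(dα)_r(v, w) = ∂_v (α(w)) - ∂_w (α(v))` at `r`, where `α(v)`, `α(w)` are functions on `ℝᵏ` with
values in the vector fields on `M`, differentiated at each point of `M`. -/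
def extDer (α : PreOneForm n M Φ) {k : ℕ} (p : Par k → Φ) (r v w : Par k) (m : M) :
    TangentSpace (𝓡 n) m :=
  fderiv ℝ (fun s : Par k => α p s w m) r v - fderiv ℝ (fun s : Par k => α p s v m) r w

/-- The bracket of `𝔡𝔦𝔣𝔣(M)`-valued 1-forms,
`[α, β](v, w) = [α(v), β(w)] - [α(w), β(v)]`, on a plot. -/
def formBracket (α β : PreOneForm n M Φ) {k : ℕ} (p : Par k → Φ) (r v w : Par k) (m : M) :
    TangentSpace (𝓡 n) m :=
  diffBracket (α p r v) (β p r w) m - diffBracket (α p r w) (β p r v) m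

/-- The curvature 2-form `Ω = dθ + ½ [θ, θ]`, on a plot. -/
def curvature (θ : PreOneForm n M Φ) {k : ℕ} (p : Par k → Φ) (r v w : Par k) (m : M) :
    TangentSpace (𝓡 n) m :=
  extDer θ p r v w m + (1 / 2 : ℝ) • formBracket θ θ p r v w m

/-- The differential `du` of a map `u : Φ → Diff(N, M)`, on a plot:
`(du)_r(v)` is the vector field `x ↦ ∂_v (u(p(·))(x)) ∈ T_{u(p(r))(x)} M` along `u(p(r))`. -/
def differential (u : Φ → Diff n N M) {k : ℕ} (p : Par k → Φ) (r v : Par k) (x : N) :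
    TangentSpace (𝓡 n) (u (p r) x) :=
  mfderiv 𝓘(ℝ, Par k) (𝓡 n) (fun s : Par k => u (p s) x) r v

/-- The 1-form `ω₀ = -du ∘ u⁻¹`. -/
def dressingConnection (u : Φ → Diff n N M) : PreOneForm n M Φ :=
  fun p r v m =>
    -((u (p r)).apply_symm_apply m ▸ differential u p r v ((u (p r)).symm m))

end Forms

end FieldSpace

end

open scoped Topology

/-! Since each `u (p r)` is bijective, every point of `M` is `u (p r) x` for some `x`, and there
ω₀(v) = -∂_v (u(p(·)) x). This is `dressingConnection_apply`; it removes u⁻¹, and every clause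
becomes a derivative of s ↦ u(p s) x with x frozen. Equivariance is the chain rule for ψ⁻¹ ∘ u.
Verticality holds because u(φ^{ψ_τ}) x = ψ_τ⁻¹(u(φ) x), and inversion in Diff(M) has derivative -1
at the identity; the two signs cancel. For flatness, the convention for the bracket turns the
curvature into ∂_v ω₀(w) - ∂_w ω₀(v) - [ω₀(v), ω₀(w)] with the usual Lie bracket. In a chart, let
g(s) represent u(p s) x. Differentiating ω₀(w) = -∂_w g along the graph of g gives a parameter
derivative plus a derivative in the direction ∂_v g = -ω₀(v). Antisymmetrising in v, w makes the
latter the Lie bracket, while the second derivatives of g cancel by symmetry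
(`flat_of_eq_neg_fderiv`). -/

/-- If `a` and `b` are the values on `v` and `w` of a family of vector fields on `E`, parametrised by
`F`, and equal `-∂_v g` and `-∂_w g` along the graph of `g`, then the family is flat at the graph:
`∂_v b - ∂_w a = [a, b]`. -/
lemma flat_of_eq_neg_fderiv {E F : Type*} [NormedAddCommGroup E] [NormedSpace ℝ E]
    [NormedAddCommGroup F] [NormedSpace ℝ F] {g : F → E} {a b : F × E → E} {r v w : F}
    (hg : ContDiffAt ℝ 2 g r) (hda : DifferentiableAt ℝ a (r, g r))
    (hdb : DifferentiableAt ℝ b (r, g r))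
    (ha : ∀ᶠ s in 𝓝 r, a (s, g s) = -fderiv ℝ g s v)
    (hb : ∀ᶠ s in 𝓝 r, b (s, g s) = -fderiv ℝ g s w) :
    fderiv ℝ (fun s => b (s, g r)) r v - fderiv ℝ (fun s => a (s, g r)) r w -
      VectorField.lieBracket ℝ (fun y => a (r, y)) (fun y => b (r, y)) (g r) = 0 := by
  have hg1 : DifferentiableAt ℝ g r := hg.differentiableAt (by simp)
  have hg2 : DifferentiableAt ℝ (fderiv ℝ g) r :=
    (hg.fderiv_right (m := 1) (by norm_num)).differentiableAt (by simp)
  -- Total derivative along the graph s ↦ (s, g s): parameter part plus transport part equals minus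
  -- the second derivative of g.
  have total : ∀ {c : F × E → E} {z : F}, DifferentiableAt ℝ c (r, g r) →
      (∀ᶠ s in 𝓝 r, c (s, g s) = -fderiv ℝ g s z) → ∀ t : F,
      fderiv ℝ c (r, g r) (t, 0) + fderiv ℝ c (r, g r) (0, fderiv ℝ g r t) =
        -fderiv ℝ (fderiv ℝ g) r t z := by
    intro c z hc hcz t
    have h1 : HasFDerivAt (fun s => c (s, g s)) ((fderiv ℝ c (r, g r)).comp
        ((ContinuousLinearMap.id ℝ F).prod (fderiv ℝ g r))) r :=
      HasFDerivAt.comp (f := fun s => (s, g s)) r hc.hasFDerivAt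
        ((hasFDerivAt_id r).prodMk hg1.hasFDerivAt)
    have h2 : HasFDerivAt (fun s => -fderiv ℝ g s z)
        (-((fderiv ℝ (fderiv ℝ g) r).flip z)) r := by
      have h := (hg2.hasFDerivAt.clm_apply (hasFDerivAt_const z r)).neg
      simp only [ContinuousLinearMap.comp_zero, zero_add] at h
      exact h
    have h3 := DFunLike.congr_fun (h1.unique (h2.congr_of_eventuallyEq hcz)) t
    simpa [← map_add] using h3
  have left : ∀ {c : F × E → E}, DifferentiableAt ℝ c (r, g r) → ∀ t : F,
      fderiv ℝ (fun s => c (s, g r)) r t = fderiv ℝ c (r, g r) (t, 0) := by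
    intro c hc t
    have h1 : HasFDerivAt (fun s => c (s, g r)) ((fderiv ℝ c (r, g r)).comp
        ((ContinuousLinearMap.id ℝ F).prod 0)) r :=
      HasFDerivAt.comp (f := fun s => (s, g r)) r hc.hasFDerivAt
        ((hasFDerivAt_id r).prodMk (hasFDerivAt_const _ _))
    rw [h1.fderiv]; rfl
  have right : ∀ {c : F × E → E}, DifferentiableAt ℝ c (r, g r) → ∀ e : E,
      fderiv ℝ (fun y => c (r, y)) (g r) e = fderiv ℝ c (r, g r) (0, e) := by
    intro c hc e
    have h1 : HasFDerivAt (fun y => c (r, y)) ((fderiv ℝ c (r, g r)).comp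
        ((0 : E →L[ℝ] F).prod (ContinuousLinearMap.id ℝ E))) (g r) :=
      HasFDerivAt.comp (f := fun y => (r, y)) (g r) hc.hasFDerivAt
        ((hasFDerivAt_const _ _).prodMk (hasFDerivAt_id _))
    rw [h1.fderiv]; rfl
  have hsymm : fderiv ℝ (fderiv ℝ g) r v w = fderiv ℝ (fderiv ℝ g) r w v :=
    (hg.isSymmSndFDerivAt (by simp)).eq v w
  have e1 := total hdb hb v
  have e2 := total hda ha w
  rw [VectorField.lieBracket, left hda, left hdb, right hda, right hdb, ha.self_of_nhds,
    hb.self_of_nhds]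
  have neg0 : ∀ (L : F × E →L[ℝ] E) (e : E), L (0, -e) = -L (0, e) := fun L e => by
    rw [← map_neg]; simp
  rw [neg0, neg0]
  -- The bracket differentiates in the directions a = -∂_v g and b = -∂_w g, so it supplies exactly
  -- the transport parts of `e1` and `e2`.
  linear_combination (norm := module) e1 - e2 - hsymm

/-! ### Smooth families of diffeomorphisms and their velocities -/

namespace FieldSpace

variable {n : ℕ} {N M Φ : Type*}
  [TopologicalSpace N] [ChartedSpace (EuclideanSpace ℝ (Fin n)) N]
  [TopologicalSpace M] [ChartedSpace (EuclideanSpace ℝ (Fin n)) M]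

/-- All tangent spaces are definitionally the model space, so transport along an equality of base
points does nothing. -/
lemma tangentSpace_cast {a b : M} (h : a = b) (t : TangentSpace (𝓡 n) a) :
    (h ▸ t : TangentSpace (𝓡 n) b) = (show EuclideanSpace ℝ (Fin n) from t) := by
  subst h; rfl

lemma contMDiff_uncurry {k : ℕ} {p : Par k → Diff n N M} (hp : IsPlot p) :
    ContMDiff (𝓘(ℝ, Par k).prod (𝓡 n)) (𝓡 n) ∞ (fun x : Par k × N => p x.1 x.2) := by
  rw [← contMDiffOn_univ, ← Set.univ_prod_univ]
  exact And.left hp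

lemma contMDiff_uncurry_symm {k : ℕ} {p : Par k → Diff n N M} (hp : IsPlot p) :
    ContMDiff (𝓘(ℝ, Par k).prod (𝓡 n)) (𝓡 n) ∞ (fun x : Par k × M => (p x.1).symm x.2) := by
  rw [← contMDiffOn_univ, ← Set.univ_prod_univ]
  exact And.right hp

lemma contMDiff_apply_const {k : ℕ} {p : Par k → Diff n N M} (hp : IsPlot p) (x : N) :
    ContMDiff 𝓘(ℝ, Par k) (𝓡 n) ∞ (fun s : Par k => p s x) :=
  (contMDiff_uncurry hp).comp (contMDiff_id.prodMk contMDiff_const)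

lemma contMDiff_symm_apply_const {k : ℕ} {p : Par k → Diff n N M} (hp : IsPlot p) (y : M) :
    ContMDiff 𝓘(ℝ, Par k) (𝓡 n) ∞ (fun s : Par k => (p s).symm y) :=
  (contMDiff_uncurry_symm hp).comp (contMDiff_id.prodMk contMDiff_const)

lemma mfderiv_apply_eq_mfderiv_uncurry {k : ℕ} {p : Par k → Diff n N M} (hp : IsPlot p)
    (r v : Par k) (x : N) :
    mfderiv 𝓘(ℝ, Par k) (𝓡 n) (fun s : Par k => p s x) r v =
      mfderiv (𝓘(ℝ, Par k).prod (𝓡 n)) (𝓡 n) (fun y : Par k × N => p y.1 y.2) (r, x)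
        ((v, 0) : Par k × EuclideanSpace ℝ (Fin n)) := by
  refine Eq.symm ((mfderiv_prod_eq_add_apply
    ((contMDiff_uncurry hp).mdifferentiableAt (by simp))).trans ?_)
  erw [map_zero, add_zero]

/-- The velocity is the tangent map of (r, x) ↦ p r x applied to the smooth vector field (v, 0). -/
lemma contMDiff_velocity [IsManifold (𝓡 n) ∞ M] [IsManifold (𝓡 n) ∞ N]
    {k : ℕ} {p : Par k → Diff n N M} (hp : IsPlot p) (v : Par k) :
    ContMDiff (𝓘(ℝ, Par k).prod (𝓡 n)) (𝓡 n).tangent ∞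
      (fun y : Par k × N => (⟨p y.1 y.2,
        mfderiv 𝓘(ℝ, Par k) (𝓡 n) (fun s : Par k => p s y.2) y.1 v⟩ : TangentBundle (𝓡 n) M)) := by
  have h1 : ContMDiff 𝓘(ℝ, Par k) 𝓘(ℝ, Par k).tangent ∞
      (fun r : Par k => (⟨r, v⟩ : TangentBundle 𝓘(ℝ, Par k) (Par k))) :=
    contMDiff_vectorSpace_iff_contDiff.2 contDiff_const
  have h2 : ContMDiff (𝓡 n) (𝓡 n).tangent ∞
      (fun x : N => (⟨x, 0⟩ : TangentBundle (𝓡 n) N)) :=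
    Bundle.contMDiff_zeroSection ℝ (TangentSpace (𝓡 n) : N → Type _)
  have h3 : ContMDiff (𝓘(ℝ, Par k).prod (𝓡 n)) (𝓘(ℝ, Par k).prod (𝓡 n)).tangent ∞
      (fun y : Par k × N => (equivTangentBundleProd 𝓘(ℝ, Par k) (Par k) (𝓡 n) N).symm
        (⟨y.1, v⟩, ⟨y.2, 0⟩)) :=
    contMDiff_equivTangentBundleProd_symm.comp
      ((h1.comp contMDiff_fst).prodMk (h2.comp contMDiff_snd))
  have h4 := ((contMDiff_uncurry hp).contMDiff_tangentMap (m := ∞) (by simp)).comp h3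
  convert h4 using 2 with y
  simp only [Function.comp]
  congr 1
  exact mfderiv_apply_eq_mfderiv_uncurry hp _ _ _

/-! ### The 1-form ω₀ -/

lemma dressingConnection_apply (u : Φ → Diff n N M) {k : ℕ} (p : Par k → Φ) (r v : Par k) (x : N) :
    dressingConnection u p r v (u (p r) x) =
      -(mfderiv 𝓘(ℝ, Par k) (𝓡 n) (fun s : Par k => u (p s) x) r v) := by
  have h : ∀ y, y = x → -(show EuclideanSpace ℝ (Fin n) from differential u p r v y) =
      -(show EuclideanSpace ℝ (Fin n) from
        mfderiv 𝓘(ℝ, Par k) (𝓡 n) (fun s : Par k => u (p s) x) r v) := by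
    rintro y rfl; rfl
  unfold dressingConnection
  rw [tangentSpace_cast]
  exact h _ ((u (p r)).symm_apply_apply x)

lemma exists_eq_apply (f : Diff n N M) (m : M) : ∃ x, m = f x :=
  ⟨f.symm m, (f.apply_symm_apply m).symm⟩

lemma isOneForm_dressingConnection [DiffeologicalSpace Φ]
    [IsManifold (𝓡 n) ∞ M] [IsManifold (𝓡 n) ∞ N]
    {u : Φ → Diff n N M} (hu : DSmooth u) : IsOneForm (dressingConnection u) where
  map_add p hp r v w m := by
    obtain ⟨x, rfl⟩ := exists_eq_apply (u (p r)) m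
    simp only [dressingConnection_apply]
    erw [map_add, neg_add]
  map_smul p hp r c v m := by
    obtain ⟨x, rfl⟩ := exists_eq_apply (u (p r)) m
    simp only [dressingConnection_apply]
    erw [map_smul, smul_neg]
  smooth {k} p hp v := by
    have hup : IsPlot fun s => u (p s) := hp.dSmooth_comp' hu
    -- Using -v absorbs the sign of ω₀ by linearity; the inner map is (r, m) ↦ (r, u(p r)⁻¹ m).
    have h := (contMDiff_velocity hup (-v)).comp
      (contMDiff_fst.prodMk (contMDiff_uncurry_symm hup))
    convert h using 1
    funext ⟨r, m⟩
    obtain ⟨x, rfl⟩ := exists_eq_apply (u (p r)) m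
    -- The base point is generalised so that the equality can be substituted in spite of the
    -- dependent fibre; the same device recurs below.
    have key : ∀ y, y = x → (⟨u (p r) x, dressingConnection u p r v (u (p r) x)⟩ :
        TangentBundle (𝓡 n) M) =
        ⟨u (p r) y, mfderiv 𝓘(ℝ, Par k) (𝓡 n) (fun s => u (p s) y) r (-v)⟩ := by
      rintro y rfl
      rw [dressingConnection_apply]
      congr 1
      exact (map_neg _ v).symm
    exact key _ ((u (p r)).symm_apply_apply x)
  reparam p f hp hf s w m := by
    have hup : IsPlot fun s => u (p s) := hp.dSmooth_comp' hu
    obtain ⟨x, rfl⟩ := exists_eq_apply (u (p (f s))) m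
    refine (dressingConnection_apply u (p ∘ f) s w x).trans
      (Eq.trans ?_ (dressingConnection_apply u p (f s) _ x).symm)
    congr 1
    have h := mfderiv_comp (I := 𝓘(ℝ, Par _)) (I' := 𝓘(ℝ, Par _)) (I'' := 𝓡 n) s
      (g := fun r => u (p r) x) (f := f)
      ((contMDiff_apply_const hup x).mdifferentiableAt (by simp))
      (hf.contMDiff.mdifferentiableAt (by simp))
    rw [mfderiv_eq_fderiv] at h
    exact DFunLike.congr_fun h w

/-! ### Verticality and equivariance -/

/-- Differentiate q_s(q_s⁻¹ m) = m at s = r: since q_r = id, the derivative in the space variable is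
the identity. -/
lemma mfderiv_symm_apply_of_eq_refl {k : ℕ} {q : Par k → Diff n M M}
    (hq : IsPlot q) {r : Par k} (hr : q r = Diffeomorph.refl (𝓡 n) M ∞) (v : Par k) (m : M) :
    (mfderiv 𝓘(ℝ, Par k) (𝓡 n) (fun s => (q s).symm m) r v : EuclideanSpace ℝ (Fin n)) =
      -(show EuclideanSpace ℝ (Fin n) from
        mfderiv 𝓘(ℝ, Par k) (𝓡 n) (fun s => q s m) r v) := by
  have hsymm : (q r).symm m = m := by rw [hr]; rfl
  have h := mfderiv_comp (I := 𝓘(ℝ, Par k)) (I' := 𝓘(ℝ, Par k).prod (𝓡 n)) (I'' := 𝓡 n) r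
    (g := fun y : Par k × M => q y.1 y.2) (f := fun s : Par k => (s, (q s).symm m))
    ((contMDiff_uncurry hq).mdifferentiableAt (by simp))
    (mdifferentiableAt_id.prodMk ((contMDiff_symm_apply_const hq m).mdifferentiableAt (by simp)))
  have hconst : ((fun y : Par k × M => q y.1 y.2) ∘ fun s : Par k => (s, (q s).symm m)) =
      fun _ => m := funext fun s => (q s).apply_symm_apply m
  have hpair := mfderiv_prodMk (I := 𝓘(ℝ, Par k)) (I' := 𝓘(ℝ, Par k)) (I'' := 𝓡 n) (x := r)
    (f := fun s : Par k => s) (g := fun s : Par k => (q s).symm m)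
    mdifferentiableAt_id ((contMDiff_symm_apply_const hq m).mdifferentiableAt (by simp))
  have hid : mfderiv 𝓘(ℝ, Par k) 𝓘(ℝ, Par k) (fun s : Par k => s) r =
      ContinuousLinearMap.id _ _ := mfderiv_id
  have hrefl : mfderiv (𝓡 n) (𝓡 n) (fun z => q r z) m = ContinuousLinearMap.id _ _ := by
    rw [hr]; exact mfderiv_id
  rw [hconst, mfderiv_const, hpair, hid] at h
  have h1 := DFunLike.congr_fun h v
  have h2 := mfderiv_prod_eq_add_apply (I := 𝓘(ℝ, Par k)) (I' := 𝓡 n) (I'' := 𝓡 n)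
    (f := fun y : Par k × M => q y.1 y.2) (p := (r, (q r).symm m))
    (v := (v, mfderiv 𝓘(ℝ, Par k) (𝓡 n) (fun s => (q s).symm m) r v))
    ((contMDiff_uncurry hq).mdifferentiableAt (by simp))
  have key : ∀ (z : M) (w : EuclideanSpace ℝ (Fin n)), z = m →
      (show EuclideanSpace ℝ (Fin n) from mfderiv 𝓘(ℝ, Par k) (𝓡 n) (fun s => q s z) r v) +
        (show EuclideanSpace ℝ (Fin n) from mfderiv (𝓡 n) (𝓡 n) (fun y => q r y) z w) =
      (show EuclideanSpace ℝ (Fin n) from mfderiv 𝓘(ℝ, Par k) (𝓡 n) (fun s => q s m) r v) + w := by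
    rintro z w rfl
    rw [hrefl]; rfl
  exact eq_neg_of_add_eq_zero_right ((key _ _ hsymm).symm.trans (h1.trans h2).symm)

lemma isPlot_comp_coord {ψ : ℝ → Diff n M M} (hψ : DSmooth ψ) :
    IsPlot (fun s : Par 1 => ψ (s 0)) :=
  hψ 1 (fun s : Par 1 => s 0) (ContDiff.isPlot (by fun_prop : ContDiff ℝ ∞ fun s : Par 1 => s 0))

/-- `Generates` uses curves on ℝ, `evalVelocity` plots on `Par 1`; the chain rule along τ ↦ τ e₀
reconciles them. -/
lemma mfderiv_curve_eq_mfderiv_comp_coord {ψ : ℝ → Diff n M M} (hψ : DSmooth ψ) (m : M) :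
    (mfderiv 𝓘(ℝ, ℝ) (𝓡 n) (fun τ : ℝ => ψ τ m) 0 (1 : ℝ) : EuclideanSpace ℝ (Fin n)) =
      (mfderiv 𝓘(ℝ, Par 1) (𝓡 n) (fun s : Par 1 => ψ (s 0) m) 0 (EuclideanSpace.single 0 1) :
        EuclideanSpace ℝ (Fin n)) := by
  have hq := isPlot_comp_coord hψ
  have hline : HasFDerivAt (fun τ : ℝ => τ • (EuclideanSpace.single 0 1 : Par 1))
      ((ContinuousLinearMap.id ℝ ℝ).smulRight (EuclideanSpace.single 0 1 : Par 1)) 0 :=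
    ((ContinuousLinearMap.id ℝ ℝ).smulRight (EuclideanSpace.single 0 1 : Par 1)).hasFDerivAt
  have h0 : (0 : ℝ) • (EuclideanSpace.single 0 1 : Par 1) = 0 := zero_smul _ _
  have h := mfderiv_comp_of_eq (I := 𝓘(ℝ, ℝ)) (I' := 𝓘(ℝ, Par 1)) (I'' := 𝓡 n) (x := 0)
    (g := fun s : Par 1 => ψ (s 0) m)
    (f := fun τ : ℝ => τ • (EuclideanSpace.single 0 1 : Par 1))
    ((contMDiff_apply_const hq m).mdifferentiableAt (by simp))
    hline.differentiableAt.mdifferentiableAt h0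
  have hcomp : ((fun s : Par 1 => ψ (s 0) m) ∘
      fun τ : ℝ => τ • (EuclideanSpace.single 0 1 : Par 1)) = fun τ => ψ τ m := by
    funext τ; simp
  rw [hcomp, mfderiv_eq_fderiv, hline.fderiv] at h
  have key : ∀ s₀ : Par 1, s₀ = 0 →
      (mfderiv 𝓘(ℝ, Par 1) (𝓡 n) (fun s : Par 1 => ψ (s 0) m) s₀
        ((1 : ℝ) • (EuclideanSpace.single 0 1 : Par 1)) : EuclideanSpace ℝ (Fin n)) =
      mfderiv 𝓘(ℝ, Par 1) (𝓡 n) (fun s : Par 1 => ψ (s 0) m) 0 (EuclideanSpace.single 0 1) := by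
    rintro _ rfl
    rw [one_smul]
  exact (DFunLike.congr_fun h (1 : ℝ)).trans (key _ h0)

lemma isEhresmannConnection_dressingConnection [DiffeologicalSpace Φ]
    [IsManifold (𝓡 n) ∞ M] [IsManifold (𝓡 n) ∞ N]
    {R : RightAction n M Φ} {u : Φ → Diff n N M} (hu : IsDressingField R u) :
    IsEhresmannConnection R (dressingConnection u) where
  isOneForm := isOneForm_dressingConnection hu.smooth
  vertical φ X ψ hψ := by
    funext m
    obtain ⟨x, rfl⟩ := exists_eq_apply (u φ) m
    have h0 : u (R.act φ (ψ ((0 : Par 1) 0))) = u φ := by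
      rw [PiLp.zero_apply, hψ.at_zero, R.act_id]
    have hq := isPlot_comp_coord hψ.smooth
    have hvel := mfderiv_curve_eq_mfderiv_comp_coord hψ.smooth (u φ x)
    have hfun : (fun s : Par 1 => u (R.act φ (ψ (s 0))) x) =
        fun s => (ψ (s 0)).symm (u φ x) := by
      funext s; rw [hu.equivariant]; rfl
    have h : ∀ y, y = u (R.act φ (ψ ((0 : Par 1) 0))) x →
        (dressingConnection u (fun r : Par 1 => R.act φ (ψ (r 0))) 0
          (EuclideanSpace.single 0 1) y : EuclideanSpace ℝ (Fin n)) =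
        -(show EuclideanSpace ℝ (Fin n) from mfderiv 𝓘(ℝ, Par 1) (𝓡 n)
          (fun s : Par 1 => (ψ (s 0)).symm (u φ x)) 0 (EuclideanSpace.single 0 1)) := by
      rintro _ rfl
      rw [← hfun]
      exact dressingConnection_apply u (fun r : Par 1 => R.act φ (ψ (r 0))) 0
        (EuclideanSpace.single 0 1) x
    refine (h _ (by rw [h0])).trans ?_
    have h2 := mfderiv_symm_apply_of_eq_refl hq (r := 0) hψ.at_zero (EuclideanSpace.single 0 1)
      (u φ x)
    refine (congrArg Neg.neg h2).trans ((neg_neg _).trans ?_)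
    exact hvel.symm.trans (hψ.velocity _)
  equivariant ψ {k} p hp r v m := by
    have hup : IsPlot fun s => u (p s) := hp.dSmooth_comp' hu.smooth
    obtain ⟨x, hx⟩ := exists_eq_apply (u (p r)) (ψ m)
    have hm : m = u (R.act (p r) ψ) x := by
      rw [hu.equivariant]
      exact (ψ.symm_apply_apply m).symm.trans (congrArg ψ.symm hx)
    have h1 : ∀ y, y = u (R.act (p r) ψ) x →
        (dressingConnection u (fun s => R.act (p s) ψ) r v y : EuclideanSpace ℝ (Fin n)) =
        -(show EuclideanSpace ℝ (Fin n) from mfderiv 𝓘(ℝ, Par k) (𝓡 n)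
          (fun s => u (R.act (p s) ψ) x) r v) := by
      rintro _ rfl
      exact dressingConnection_apply u (fun s => R.act (p s) ψ) r v x
    have h2 : ∀ z, z = u (p r) x →
        (mfderiv (𝓡 n) (𝓡 n) ψ.symm z (dressingConnection u p r v z) :
          EuclideanSpace ℝ (Fin n)) =
        -(show EuclideanSpace ℝ (Fin n) from mfderiv (𝓡 n) (𝓡 n) ψ.symm (u (p r) x)
          (mfderiv 𝓘(ℝ, Par k) (𝓡 n) (fun s => u (p s) x) r v)) := by
      rintro _ rfl
      rw [dressingConnection_apply]
      exact map_neg _ _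
    refine (h1 m hm).trans (Eq.trans ?_ (h2 _ hx).symm)
    congr 1
    have hfun : (fun s => u (R.act (p s) ψ) x) = ψ.symm ∘ fun s => u (p s) x := by
      funext s; rw [hu.equivariant]; rfl
    rw [hfun]
    exact DFunLike.congr_fun (mfderiv_comp r (ψ.symm.contMDiff.mdifferentiableAt (by simp))
      ((contMDiff_apply_const hup x).mdifferentiableAt (by simp))) v

/-! ### Flatness, read in a chart -/

/-- The representation of the vector field `(p^*α)_s(w)` in the chart at `m`. -/
noncomputable def chartForm (α : PreOneForm n M Φ) {k : ℕ} (p : Par k → Φ) (m : M) (w : Par k)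
    (z : Par k × EuclideanSpace ℝ (Fin n)) : EuclideanSpace ℝ (Fin n) :=
  VectorField.mpullbackWithin 𝓘(ℝ, EuclideanSpace ℝ (Fin n)) (𝓡 n) (extChartAt (𝓡 n) m).symm
    (α p z.1 w) (Set.range (𝓡 n)) z.2

/-- The derivatives of the chart and of its inverse are mutually inverse, so this pullback is a
pushforward by the chart. -/
lemma chartForm_apply [IsManifold (𝓡 n) ∞ M] (α : PreOneForm n M Φ) {k : ℕ} (p : Par k → Φ)
    {m y : M} (hy : y ∈ (extChartAt (𝓡 n) m).source) (w s : Par k) :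
    chartForm α p m w (s, extChartAt (𝓡 n) m y) =
      mfderiv (𝓡 n) 𝓘(ℝ, EuclideanSpace ℝ (Fin n)) (extChartAt (𝓡 n) m) y (α p s w y) := by
  have : IsManifold (𝓡 n) 1 M := .of_le (n := ∞) (by simp)
  have hinv : (mfderivWithin 𝓘(ℝ, EuclideanSpace ℝ (Fin n)) (𝓡 n) (extChartAt (𝓡 n) m).symm
      (Set.range (𝓡 n)) (extChartAt (𝓡 n) m y)).inverse =
      mfderiv (𝓡 n) 𝓘(ℝ, EuclideanSpace ℝ (Fin n)) (extChartAt (𝓡 n) m) y :=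
    ContinuousLinearMap.inverse_eq
      (mfderivWithin_extChartAt_symm_comp_mfderiv_extChartAt' hy)
      (mfderiv_extChartAt_comp_mfderivWithin_extChartAt_symm' hy)
  have key : ∀ z, z = y →
      (mfderiv (𝓡 n) 𝓘(ℝ, EuclideanSpace ℝ (Fin n)) (extChartAt (𝓡 n) m) y
        (show EuclideanSpace ℝ (Fin n) from α p s w z) : EuclideanSpace ℝ (Fin n)) =
      mfderiv (𝓡 n) 𝓘(ℝ, EuclideanSpace ℝ (Fin n)) (extChartAt (𝓡 n) m) y (α p s w y) := by
    rintro _ rfl; rfl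
  exact (DFunLike.congr_fun hinv _).trans (key _ ((extChartAt (𝓡 n) m).left_inv hy))

lemma chartForm_self [IsManifold (𝓡 n) ∞ M] (α : PreOneForm n M Φ) {k : ℕ} (p : Par k → Φ)
    (m : M) (w s : Par k) :
    chartForm α p m w (s, extChartAt (𝓡 n) m m) = α p s w m := by
  have : IsManifold (𝓡 n) 1 M := .of_le (n := ∞) (by simp)
  rw [chartForm_apply α p (mem_extChartAt_source m), mfderiv_extChartAt_self]
  rfl

/-- Near the centre, the chart derivative is the fibre part of the tangent bundle trivialization at
m, in which joint smoothness of α can be read off. -/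
lemma differentiableAt_chartForm [DiffeologicalSpace Φ] [IsManifold (𝓡 n) ∞ M]
    {α : PreOneForm n M Φ} (hα : IsOneForm α) {k : ℕ} {p : Par k → Φ} (hp : IsPlot p) (m : M) (w r : Par k) :
    DifferentiableAt ℝ (chartForm α p m w) (r, extChartAt (𝓡 n) m m) := by
  have : IsManifold (𝓡 n) 1 M := .of_le (n := ∞) (by simp)
  have h0 : (extChartAt (𝓡 n) m).symm (extChartAt (𝓡 n) m m) = m := extChartAt_to_inv m
  have hf : ContMDiffAt (𝓘(ℝ, Par k).prod 𝓘(ℝ, EuclideanSpace ℝ (Fin n)))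
      (𝓘(ℝ, Par k).prod (𝓡 n)) ∞
      (fun z : Par k × EuclideanSpace ℝ (Fin n) => (z.1, (extChartAt (𝓡 n) m).symm z.2))
      (r, extChartAt (𝓡 n) m m) := by
    refine contMDiffAt_fst.prodMk ?_
    have h1 : ContMDiffAt 𝓘(ℝ, EuclideanSpace ℝ (Fin n)) (𝓡 n) ∞ (extChartAt (𝓡 n) m).symm
        (extChartAt (𝓡 n) m m) :=
      (contMDiffOn_extChartAt_symm m).contMDiffAt (extChartAt_target_mem_nhds m)
    exact ContMDiffAt.comp (r, extChartAt (𝓡 n) m m) h1 contMDiffAt_snd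
  have h2 := ((hα.smooth p hp w).contMDiffAt.comp _ hf)
  rw [Bundle.contMDiffAt_totalSpace] at h2
  have h3 := h2.2
  rw [← modelWithCornersSelf_prod, chartedSpaceSelf_prod, contMDiffAt_iff_contDiffAt] at h3
  refine (h3.differentiableAt (by simp)).congr_of_eventuallyEq ?_
  have hev : ∀ᶠ z : Par k × EuclideanSpace ℝ (Fin n) in 𝓝 (r, extChartAt (𝓡 n) m m),
      z.2 ∈ (extChartAt (𝓡 n) m).target :=
    (continuousAt_snd (p := (r, extChartAt (𝓡 n) m m))).eventually
      (extChartAt_target_mem_nhds (I := 𝓡 n) m)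
  filter_upwards [hev] with ⟨s, z⟩ hz
  obtain ⟨y, hy, rfl⟩ : ∃ y ∈ (extChartAt (𝓡 n) m).source, extChartAt (𝓡 n) m y = z :=
    ⟨_, (extChartAt (𝓡 n) m).map_target hz, (extChartAt (𝓡 n) m).right_inv hz⟩
  rw [chartForm_apply α p hy]
  have hy' : y ∈ (chartAt (EuclideanSpace ℝ (Fin n)) m).source := by simpa using hy
  rw [← TangentBundle.continuousLinearMapAt_trivializationAt hy']
  have key : ∀ m' y', m' = m → y' = y →
      (trivializationAt (EuclideanSpace ℝ (Fin n)) (TangentSpace (𝓡 n)) m).continuousLinearMapAt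
        ℝ y (α p s w y) =
      (trivializationAt (EuclideanSpace ℝ (Fin n)) (TangentSpace (𝓡 n)) m'
        (⟨y', α p s w y'⟩ : TangentBundle (𝓡 n) M)).2 := by
    rintro _ _ rfl rfl
    exact Bundle.Trivialization.continuousLinearMapAt_apply_of_mem ℝ
      (trivializationAt (EuclideanSpace ℝ (Fin n)) (TangentSpace (𝓡 n)) _) hy' _
  exact key _ _ h0 ((extChartAt (𝓡 n) m).left_inv hy)

/-- The manifold bracket is defined by pulling back to the chart at m, whose derivative at m is the
identity. -/
lemma mlieBracket_eq_lieBracket_chartForm [IsManifold (𝓡 n) ∞ M] (α : PreOneForm n M Φ) {k : ℕ}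
    (p : Par k → Φ) (m : M) (r v w : Par k) :
    VectorField.mlieBracket (𝓡 n) (α p r v) (α p r w) m =
      VectorField.lieBracket ℝ (fun y => chartForm α p m v (r, y))
        (fun y => chartForm α p m w (r, y)) (extChartAt (𝓡 n) m m) := by
  have : IsManifold (𝓡 n) 1 M := .of_le (n := ∞) (by simp)
  rw [← VectorField.mlieBracketWithin_univ, VectorField.mlieBracketWithin_apply,
    ModelWithCorners.Boundaryless.range_eq_univ, Set.preimage_univ, Set.univ_inter]
  have hinv : (mfderiv (𝓡 n) 𝓘(ℝ, EuclideanSpace ℝ (Fin n)) (extChartAt (𝓡 n) m) m).inverse =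
      ContinuousLinearMap.id ℝ (EuclideanSpace ℝ (Fin n)) := by
    rw [mfderiv_extChartAt_self]
    exact ContinuousLinearMap.inverse_id
  refine (DFunLike.congr_fun hinv _).trans ?_
  refine Eq.trans ?_ (congrFun (VectorField.lieBracketWithin_univ (𝕜 := ℝ)
    (V := fun y => chartForm α p m v (r, y)) (W := fun y => chartForm α p m w (r, y))) _)
  unfold chartForm
  rw [ModelWithCorners.Boundaryless.range_eq_univ]
  rfl

lemma chartForm_dressingConnection [DiffeologicalSpace Φ] [IsManifold (𝓡 n) ∞ M]
    {u : Φ → Diff n N M} (hu : DSmooth u)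
    {k : ℕ} {p : Par k → Φ} (hp : IsPlot p) {m : M} {x : N} {s : Par k}
    (hs : u (p s) x ∈ (extChartAt (𝓡 n) m).source) (w : Par k) :
    chartForm (dressingConnection u) p m w (s, extChartAt (𝓡 n) m (u (p s) x)) =
      -fderiv ℝ (fun t => extChartAt (𝓡 n) m (u (p t) x)) s w := by
  have : IsManifold (𝓡 n) 1 M := .of_le (n := ∞) (by simp)
  have hup : IsPlot fun s => u (p s) := hp.dSmooth_comp' hu
  rw [chartForm_apply _ p hs, dressingConnection_apply, map_neg]
  congr 1
  have h := mfderiv_comp (I := 𝓘(ℝ, Par k)) (I' := 𝓡 n)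
    (I'' := 𝓘(ℝ, EuclideanSpace ℝ (Fin n))) s
    (g := extChartAt (𝓡 n) m) (f := fun t => u (p t) x)
    (mdifferentiableAt_extChartAt (by simpa using hs))
    ((contMDiff_apply_const hup x).mdifferentiableAt (by simp))
  rw [mfderiv_eq_fderiv] at h
  exact (DFunLike.congr_fun h w).symm

lemma curvature_dressingConnection [DiffeologicalSpace Φ]
    [IsManifold (𝓡 n) ∞ M] [IsManifold (𝓡 n) ∞ N]
    {u : Φ → Diff n N M} (hu : DSmooth u) {k : ℕ} {p : Par k → Φ} (hp : IsPlot p)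
    (r v w : Par k) (m : M) : curvature (dressingConnection u) p r v w m = 0 := by
  have hup : IsPlot fun s => u (p s) := hp.dSmooth_comp' hu
  obtain ⟨x, rfl⟩ := exists_eq_apply (u (p r)) m
  set m := u (p r) x with hm
  have hform := isOneForm_dressingConnection hu
  have hU := contMDiff_apply_const hup x
  have hev : ∀ᶠ s in 𝓝 r, u (p s) x ∈ (extChartAt (𝓡 n) m).source :=
    hU.continuous.continuousAt.eventually (extChartAt_source_mem_nhds m)
  have hg : ContDiffAt ℝ 2 (fun s => extChartAt (𝓡 n) m (u (p s) x)) r := by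
    rw [← contMDiffAt_iff_contDiffAt]
    exact (ContMDiffAt.comp r (contMDiffAt_extChartAt (n := ∞) (x := m)) hU.contMDiffAt).of_le
      (WithTop.coe_le_coe.2 (le_top : (2 : ℕ∞) ≤ ⊤))
  have key := flat_of_eq_neg_fderiv hg
    (differentiableAt_chartForm hform hp m v r) (differentiableAt_chartForm hform hp m w r)
    (hev.mono fun s hs => chartForm_dressingConnection hu hp hs v)
    (hev.mono fun s hs => chartForm_dressingConnection hu hp hs w)
  have hbr := mlieBracket_eq_lieBracket_chartForm (dressingConnection u) p m r v w
  simp only [← hm, chartForm_self] at key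
  rw [← hbr] at key
  -- Here c is the Lie bracket: ½[ω₀, ω₀] contributes -c twice, halved.
  have alg : ∀ a b c : EuclideanSpace ℝ (Fin n),
      a - b + (1 / 2 : ℝ) • (-c - - -c) = a - b - c := fun a b c => by module
  rw [curvature, formBracket, diffBracket, diffBracket,
    VectorField.mlieBracket_swap_apply (V := dressingConnection u p r w)]
  exact (alg _ _ _).trans key

end FieldSpace

theorem mainTheorem5 {n : ℕ} {M N Φ : Type*}
    [TopologicalSpace M] [ChartedSpace (EuclideanSpace ℝ (Fin n)) M] [IsManifold (𝓡 n) ∞ M]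
    [TopologicalSpace N] [ChartedSpace (EuclideanSpace ℝ (Fin n)) N] [IsManifold (𝓡 n) ∞ N]
    [DiffeologicalSpace Φ] (R : FieldSpace.RightAction n M Φ)
    (u : Φ → FieldSpace.Diff n N M) (hu : FieldSpace.IsDressingField R u) :
    FieldSpace.IsEhresmannConnection R (FieldSpace.dressingConnection u) ∧
      ∀ {k : ℕ} (p : FieldSpace.Par k → Φ), IsPlot p →
        ∀ (r v w : FieldSpace.Par k) (m : M),
          FieldSpace.curvature (FieldSpace.dressingConnection u) p r v w m = 0 :=
  ⟨FieldSpace.isEhresmannConnection_dressingConnection hu,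
    fun _ hp r v w m => FieldSpace.curvature_dressingConnection hu.smooth hp r v w m⟩
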